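/- A Steiner triple system of order $v$ is a pair $(V,\mathcal{B})$ where $V$ is a set of $v$ points and $\mathcal{B}$ is a collection of $3$-element subsets of $V$ (triples) such that any two distinct points occur together in exactly one triple. A partial parallel class is a set of pairwise disjoint triples of the system, and the chromatic index of $(V,\mathcal{B})$ is the smallest number of partial parallel classes into which $\mathcal{B}$ can be partitioned. Theorem. Let $v$ be a positive integer with $v \equiv 3 \pmod 6$. If $v \notin \{3, 9, 45, 75, 129, 513\}$, then there is a Steiner triple system of order $v$ with chromatic index at least $\frac{v+3}{2}$. If $v \in \{3, 9\}$, then there is no Steiner triple system of order $v$ with chromatic index at least $\frac{v+3}{2}$. (No claim is made for $v \in \{45, 75, 129, 513\}$.) -/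

import Mathlib

/-- A Steiner triple system on the finite point set `V`: a collection of 3-subsets of `V` such that
any two distinct points occur together in exactly one of them. Its order is the cardinality
of `V`. -/
structure SteinerTripleSystem (V : Type*) [Fintype V] where
  /-- the triples -/
  triples : Finset (Finset V)
  card_eq_three : ∀ t ∈ triples, t.card = 3
  existsUnique_triple : ∀ x y : V, x ≠ y → ∃! t : Finset V, t ∈ triples ∧ x ∈ t ∧ y ∈ t

namespace SteinerTripleSystem

/-- A partial parallel class: a set of triples of the system that are pairwise disjoint. -/
def IsPartialParallelClass {V : Type*} [Fintype V] (S : SteinerTripleSystem V)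
    (P : Finset (Finset V)) : Prop :=
  P ⊆ S.triples ∧ ∀ s ∈ P, ∀ t ∈ P, s ≠ t → Disjoint s t

open Classical in
/-- The triples of the system can be partitioned into exactly `k` partial parallel classes. -/
def HasPartition {V : Type*} [Fintype V] (S : SteinerTripleSystem V) (k : ℕ) : Prop :=
  ∃ Q : Finpartition S.triples, Q.parts.card = k ∧ ∀ P ∈ Q.parts, S.IsPartialParallelClass P

/-- The chromatic index: the smallest number of partial parallel classes into which the set of
triples can be partitioned. -/
noncomputable def chromaticIndex {V : Type*} [Fintype V] (S : SteinerTripleSystem V) : ℕ :=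
  sInf {k : ℕ | S.HasPartition k}

/-- A partition into partial parallel classes exists (take singletons), so the minimum that defines
the chromatic index is attained. -/
theorem hasPartition_chromaticIndex {V : Type*} [Fintype V] (S : SteinerTripleSystem V) :
    S.HasPartition S.chromaticIndex := by
  classical
  have h : {k : ℕ | S.HasPartition k}.Nonempty := by
    refine ⟨(⊥ : Finpartition S.triples).parts.card, ?_⟩
    refine ⟨⊥, by convert rfl, ?_⟩
    intro P hP
    have hP' : P ∈ (⊥ : Finpartition S.triples).parts := by convert hP
    obtain ⟨t, ht, rfl⟩ := Finpartition.mem_bot_iff.1 hP'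
    refine ⟨by simpa using ht, ?_⟩
    intro s hs u hu hsu
    rw [Finset.mem_singleton] at hs hu
    exact absurd (hs.trans hu.symm) hsu
  exact Nat.sInf_mem h

end SteinerTripleSystem

/-!
Let `v = 6 * k + 3`. A partial parallel class that is not a parallel class has at most `2 * k`
triples, so a partition into at most `3 * k + 2` partial parallel classes contains at least `k + 1`
parallel classes. This is impossible if there is a set `X` of fewer than `r * (k + 1)` triples of
which every parallel class contains at least `r`. In each construction, `X` is found by giving the
points weights for which the triples outside `X` have nearly constant sum: the triples of a parallel
class add up to the total weight of all points.

* If `v` is `15` modulo `18`, Bose's construction on `Q × ZMod 3` has the `2 * k + 1` vertical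
  triples `{x} × ZMod 3`. The second coordinate as a weight shows that the number of vertical
  triples in a parallel class is `|Q| = 2` modulo `3`, so `r = 2` works.
* If `v = 21`, the same argument on the Fano plane only gives `1` modulo `3`. The weight in
  `(ZMod 2)³` excludes exactly one vertical triple, so again `r = 2` works.
* If `v` is `3` or `9` modulo `18`, the Schreiber–Wilson construction adds three ideal points to the
  nonzero elements of `ZMod (v - 2)`. It depends on a `3`-colouring of the orbits of multiplication
  by `2`. Away from the ideal points triples have sum zero, which forces a parallel class to contain
  the ideal triple or a triple near an element of colour `0`, and colour `0` is needed only once for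
  each doubling orbit of odd length. Counting elements of small odd period bounds the number of such
  orbits, with the listed exceptions.

A system of order `9` is an affine plane, whose four directions are a `4`-colouring.
-/

namespace SteinerTripleSystem

variable {V W : Type*} [Fintype V] [Fintype W]

section Coloring

/-- The intersection graph of the triples. A proper colouring of it is the same thing as a partition
of the triples into partial parallel classes. -/
def intersectionGraph (S : SteinerTripleSystem V) : SimpleGraph S.triples where
  Adj s t := s ≠ t ∧ ¬Disjoint (s : Finset V) t
  symm := ⟨fun _ _ h ↦ ⟨h.1.symm, fun h' ↦ h.2 h'.symm⟩⟩
  loopless := ⟨fun _ h ↦ h.1 rfl⟩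

theorem HasPartition.colorable {S : SteinerTripleSystem V} {k : ℕ} (h : S.HasPartition k) :
    S.intersectionGraph.Colorable k := by
  classical
  obtain ⟨Q, rfl, hQ⟩ := h
  let C : S.intersectionGraph.Coloring Q.parts :=
    SimpleGraph.Coloring.mk (fun t ↦ ⟨Q.part t, Q.part_mem.2 t.2⟩) fun {s t} hst heq ↦ by
      have hpart : Q.part (s : Finset V) = Q.part t := congrArg Subtype.val heq
      refine hst.2 ((hQ _ (Q.part_mem.2 s.2)).2 s (Q.mem_part s.2) t ?_ (by simpa using hst.1))
      exact hpart ▸ Q.mem_part t.2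
  simpa using C.colorable

theorem chromaticIndex_le_of_colorable {S : SteinerTripleSystem V} {k : ℕ}
    (h : S.intersectionGraph.Colorable k) : S.chromaticIndex ≤ k := by
  classical
  obtain ⟨C⟩ := h
  let color (t : Finset V) : Option (Fin k) := if ht : t ∈ S.triples then some (C ⟨t, ht⟩) else none
  let Q : Finpartition S.triples := .ofSetSetoid (Setoid.ker color) S.triples
  have hQ : S.HasPartition Q.parts.card := by
    refine ⟨Q, rfl, fun P hP ↦ ⟨Q.le hP, fun s hs t ht hne ↦ ?_⟩⟩
    have hsS := Q.le hP hs
    have htS := Q.le hP ht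
    have hst : t ∈ Q.part s := (Q.part_eq_of_mem hP hs).symm ▸ ht
    have heq : color s = color t := ((Finpartition.mem_part_ofSetSetoid_iff_rel _).1 hst).2.2
    by_contra hdisj
    refine C.valid (v := ⟨s, hsS⟩) (w := ⟨t, htS⟩) ⟨by simpa using hne, hdisj⟩ ?_
    simpa [color, hsS, htS] using heq
  calc S.chromaticIndex ≤ Q.parts.card := Nat.sInf_le hQ
    _ = ((S.triples.image color).image fun c ↦ {t ∈ S.triples | c = color t}).card := by
      rw [Finset.image_image, Finpartition.ofSetSetoid_parts]
      congr! with s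
      simp [Setoid.ker_def]
    _ ≤ (S.triples.image color).card := Finset.card_image_le
    _ ≤ (Finset.univ.image (some : Fin k → Option (Fin k))).card := by
      refine Finset.card_le_card (Finset.image_subset_iff.2 fun t ht ↦ ?_)
      simp [color, ht]
    _ ≤ k := Finset.card_image_le.trans (Finset.card_fin k).le

/-- The image of a Steiner triple system under a bijection of the points, used to move a system onto
the point set `Fin v`. -/
def map (S : SteinerTripleSystem V) (e : V ≃ W) : SteinerTripleSystem W where
  triples := S.triples.map (Finset.mapEmbedding e.toEmbedding).toEmbedding
  card_eq_three := by
    intro t ht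
    obtain ⟨s, hs, rfl⟩ := Finset.mem_map.1 ht
    simpa using S.card_eq_three s hs
  existsUnique_triple := by
    intro x y hxy
    obtain ⟨t, ⟨ht, hx, hy⟩, huniq⟩ :=
      S.existsUnique_triple (e.symm x) (e.symm y) (e.symm.injective.ne hxy)
    refine ⟨t.map e.toEmbedding, ⟨Finset.mem_map.2 ⟨t, ht, rfl⟩, by simpa using hx,
      by simpa using hy⟩, ?_⟩
    rintro _ ⟨hs, hxs, hys⟩
    obtain ⟨s, hsS, rfl⟩ := Finset.mem_map.1 hs
    rw [← huniq s ⟨hsS, by simpa using hxs, by simpa using hys⟩]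
    rfl

theorem chromaticIndex_le_map (S : SteinerTripleSystem V) (e : V ≃ W) :
    S.chromaticIndex ≤ (S.map e).chromaticIndex := by
  let f : S.intersectionGraph →g (S.map e).intersectionGraph :=
    { toFun := fun t ↦ ⟨t.1.map e.toEmbedding, Finset.mem_map.2 ⟨t, t.2, rfl⟩⟩
      map_rel' := fun {s t} hst ↦
        ⟨fun h ↦ hst.1 (Subtype.ext (Finset.map_injective _ (congrArg Subtype.val h))),
          fun h ↦ hst.2 ((Finset.disjoint_map _).1 h)⟩ }
  exact chromaticIndex_le_of_colorable ((S.map e).hasPartition_chromaticIndex.colorable.of_hom f)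

theorem exists_fin_chromaticIndex_le (S : SteinerTripleSystem V) {v : ℕ}
    (hV : Fintype.card V = v) :
    ∃ S' : SteinerTripleSystem (Fin v), S.chromaticIndex ≤ S'.chromaticIndex :=
  ⟨_, S.chromaticIndex_le_map (Fintype.equivFinOfCardEq hV)⟩

end Coloring

section Counting

variable (S : SteinerTripleSystem V)

theorem eq_of_mem_of_mem {S : SteinerTripleSystem V} {s t : Finset V} (hs : s ∈ S.triples)
    (ht : t ∈ S.triples) {x y : V} (hxy : x ≠ y) (hxs : x ∈ s) (hys : y ∈ s) (hxt : x ∈ t)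
    (hyt : y ∈ t) : s = t :=
  (S.existsUnique_triple x y hxy).unique ⟨hs, hxs, hys⟩ ⟨ht, hxt, hyt⟩

theorem card_triples : 6 * S.triples.card = Fintype.card V * (Fintype.card V - 1) := by
  classical
  have hpairs : S.triples.biUnion (fun t ↦ t.offDiag) = (Finset.univ : Finset V).offDiag := by
    ext ⟨x, y⟩
    simp only [Finset.mem_biUnion, Finset.mem_offDiag, Finset.mem_univ, true_and]
    constructor
    · rintro ⟨t, -, -, -, hxy⟩
      exact hxy
    · intro hxy
      obtain ⟨t, ⟨ht, hx, hy⟩, -⟩ := S.existsUnique_triple x y hxy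
      exact ⟨t, ht, hx, hy, hxy⟩
  have hdisj : (S.triples : Set (Finset V)).PairwiseDisjoint fun t ↦ t.offDiag := by
    intro s hs t ht hst
    refine Finset.disjoint_left.2 fun ⟨x, y⟩ hs' ht' ↦ ?_
    rw [Finset.mem_offDiag] at hs' ht'
    exact hst (eq_of_mem_of_mem hs ht hs'.2.2 hs'.1 hs'.2.1 ht'.1 ht'.2.1)
  calc 6 * S.triples.card = ∑ t ∈ S.triples, t.offDiag.card := by
        rw [Finset.sum_const_nat fun t ht ↦ by rw [Finset.offDiag_card, S.card_eq_three t ht],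
          mul_comm]
    _ = Fintype.card V * (Fintype.card V - 1) := by
        rw [← Finset.card_biUnion hdisj, hpairs, Finset.offDiag_card, Finset.card_univ, Nat.mul_sub,
          mul_one]

theorem two_mul_card_triples_mem [DecidableEq V] (x : V) :
    2 * {t ∈ S.triples | x ∈ t}.card = Fintype.card V - 1 := by
  have hcover : {t ∈ S.triples | x ∈ t}.biUnion (fun t ↦ t.erase x) = Finset.univ.erase x := by
    ext y
    simp only [Finset.mem_biUnion, Finset.mem_filter, Finset.mem_erase, Finset.mem_univ, and_true]
    constructor
    · rintro ⟨t, -, hyx, -⟩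
      exact hyx
    · intro hyx
      obtain ⟨t, ⟨ht, hy, hx⟩, -⟩ := S.existsUnique_triple y x hyx
      exact ⟨t, ⟨ht, hx⟩, hyx, hy⟩
  have hdisj : ({t ∈ S.triples | x ∈ t} : Set (Finset V)).PairwiseDisjoint
      fun t ↦ t.erase x := by
    rintro s ⟨hs, hxs⟩ t ⟨ht, hxt⟩ hst
    refine Finset.disjoint_left.2 fun y hys hyt ↦ hst ?_
    rw [Finset.mem_erase] at hys hyt
    exact eq_of_mem_of_mem hs ht hys.1 hys.2 hxs hyt.2 hxt
  calc 2 * {t ∈ S.triples | x ∈ t}.card = ∑ t ∈ S.triples with x ∈ t, (t.erase x).card := by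
        rw [Finset.sum_const_nat fun t ht ↦ by
            rw [Finset.card_erase_of_mem (Finset.mem_filter.1 ht).2,
              S.card_eq_three t (Finset.mem_filter.1 ht).1],
          mul_comm]
    _ = Fintype.card V - 1 := by
        rw [← Finset.card_biUnion (by simpa using hdisj), hcover,
          Finset.card_erase_of_mem (Finset.mem_univ x), Finset.card_univ]

end Counting

section ParallelClass

variable {S : SteinerTripleSystem V} {P : Finset (Finset V)}

/-- A parallel class: a partial parallel class that covers all points. -/
def IsParallelClass (S : SteinerTripleSystem V) (P : Finset (Finset V)) : Prop :=
  S.IsPartialParallelClass P ∧ ∀ x, ∃ t ∈ P, x ∈ t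

theorem IsPartialParallelClass.card_biUnion [DecidableEq V] (hP : S.IsPartialParallelClass P) :
    (P.biUnion id).card = 3 * P.card := by
  have hthree : ∀ t ∈ P, (id t).card = 3 := fun t ht ↦ S.card_eq_three t (hP.1 ht)
  rw [Finset.card_biUnion (t := id) hP.2, Finset.sum_const_nat hthree, mul_comm]

theorem IsPartialParallelClass.three_mul_card_le (hP : S.IsPartialParallelClass P) :
    3 * P.card ≤ Fintype.card V := by
  classical
  exact hP.card_biUnion ▸ Finset.card_le_univ _

theorem IsPartialParallelClass.isParallelClass (hP : S.IsPartialParallelClass P)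
    (hcard : Fintype.card V ≤ 3 * P.card) : S.IsParallelClass P := by
  classical
  refine ⟨hP, fun x ↦ ?_⟩
  have hcover : P.biUnion id = Finset.univ :=
    Finset.eq_univ_of_card _ ((Finset.card_le_univ _).antisymm (hcard.trans hP.card_biUnion.ge))
  simpa using hcover.ge (Finset.mem_univ x)

theorem IsParallelClass.biUnion_eq_univ [DecidableEq V] (hP : S.IsParallelClass P) :
    P.biUnion id = Finset.univ := by
  ext x
  simpa using hP.2 x

theorem IsParallelClass.three_mul_card (hP : S.IsParallelClass P) :
    3 * P.card = Fintype.card V := by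
  classical
  rw [← hP.1.card_biUnion, hP.biUnion_eq_univ, Finset.card_univ]

theorem IsParallelClass.eq_of_mem (hP : S.IsParallelClass P) {s t : Finset V} (hs : s ∈ P)
    (ht : t ∈ P) {x : V} (hxs : x ∈ s) (hxt : x ∈ t) : s = t := by
  by_contra hst
  exact Finset.disjoint_left.1 (hP.1.2 s hs t ht hst) hxs hxt

theorem IsParallelClass.sum_sum {A : Type*} [AddCommMonoid A] (hP : S.IsParallelClass P)
    (w : V → A) : ∑ t ∈ P, ∑ x ∈ t, w x = ∑ x, w x := by
  classical
  rw [← hP.biUnion_eq_univ]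
  exact (Finset.sum_biUnion hP.1.2).symm

open Classical in
theorem lt_card_isParallelClass {k : ℕ} (hV : Fintype.card V = 6 * k + 3)
    (Q : Finpartition S.triples) (hQ : ∀ P ∈ Q.parts, S.IsPartialParallelClass P)
    (hcard : Q.parts.card ≤ 3 * k + 2) : k < {P ∈ Q.parts | S.IsParallelClass P}.card := by
  have hP : ∀ P ∈ Q.parts, P.card ≤ 2 * k + if S.IsParallelClass P then 1 else 0 := by
    intro P hPQ
    have hle := (hQ P hPQ).three_mul_card_le
    split_ifs with h
    · omega
    · have := mt (hQ P hPQ).isParallelClass h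
      omega
  have hle : S.triples.card ≤
      2 * k * Q.parts.card + {P ∈ Q.parts | S.IsParallelClass P}.card := by
    calc S.triples.card = ∑ P ∈ Q.parts, P.card := Q.sum_card_parts.symm
      _ ≤ ∑ P ∈ Q.parts, (2 * k + if S.IsParallelClass P then 1 else 0) := Finset.sum_le_sum hP
      _ = _ := by
        rw [Finset.sum_add_distrib, Finset.sum_const, Finset.sum_boole, smul_eq_mul, mul_comm,
          Nat.cast_id]
  have htriples := S.card_triples
  rw [hV, show 6 * k + 3 - 1 = 6 * k + 2 by omega] at htriples
  nlinarith [Nat.mul_le_mul_left (2 * k) hcard]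

theorem le_chromaticIndex [DecidableEq V] {k r : ℕ} (hV : Fintype.card V = 6 * k + 3)
    (X : Finset (Finset V)) (hX : X.card < r * (k + 1))
    (h : ∀ P, S.IsParallelClass P → r ≤ (X ∩ P).card) : 3 * k + 3 ≤ S.chromaticIndex := by
  obtain rfl : ‹DecidableEq V› = fun _ _ ↦ Classical.propDecidable _ := Subsingleton.elim _ _
  classical
  obtain ⟨Q, hQcard, hQ⟩ := S.hasPartition_chromaticIndex
  by_contra! hlt
  have hclasses := lt_card_isParallelClass hV Q hQ (by omega)
  set F := {P ∈ Q.parts | S.IsParallelClass P} with hF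
  have hdisj : ∀ t ∈ X, {P ∈ F | t ∈ P}.card ≤ 1 := fun t _ ↦ Finset.card_le_one.2 fun P hP P' hP' ↦
    Q.eq_of_mem_parts (by simp_all) (by simp_all) (Finset.mem_filter.1 hP).2
      (Finset.mem_filter.1 hP').2
  have hle : r * F.card ≤ X.card := by
    calc r * F.card = ∑ _P ∈ F, r := by simp [mul_comm]
      _ ≤ ∑ P ∈ F, (X ∩ P).card := Finset.sum_le_sum fun P hP ↦ by
        convert h P (Finset.mem_filter.1 hP).2
      _ ≤ X.card * 1 := Finset.sum_card_inter_le hdisj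
      _ = X.card := mul_one _
  exact (hle.trans_lt hX).not_ge (Nat.mul_le_mul_left r hclasses)

end ParallelClass

end SteinerTripleSystem

/-- A Steiner quasigroup (idempotent and totally symmetric), the algebraic form of a Steiner triple
system: `third x y` is the third point of the triple through `x` and `y`. -/
structure SteinerQuasigroup (V : Type*) where
  third : V → V → V
  third_self : ∀ x, third x x = x
  third_comm : ∀ x y, third x y = third y x
  third_third : ∀ x y, third x (third x y) = y

namespace SteinerQuasigroup

variable {V : Type*} (Q : SteinerQuasigroup V) {x y : V}

theorem third_third_right (x y : V) : Q.third y (Q.third x y) = x := by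
  rw [Q.third_comm x y, Q.third_third]

theorem third_ne_left (h : x ≠ y) : Q.third x y ≠ x := fun h' ↦
  h (by simpa only [h', Q.third_self] using Q.third_third x y)

theorem third_ne_right (h : x ≠ y) : Q.third x y ≠ y :=
  Q.third_comm x y ▸ Q.third_ne_left h.symm

variable [DecidableEq V]

/-- The triple through two distinct points. -/
def triple (x y : V) : Finset V := {x, y, Q.third x y}

theorem mem_triple {z : V} : z ∈ Q.triple x y ↔ z = x ∨ z = y ∨ z = Q.third x y := by
  simp [triple]

theorem card_triple (h : x ≠ y) : (Q.triple x y).card = 3 :=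
  Finset.card_eq_three.2
    ⟨x, y, Q.third x y, h, (Q.third_ne_left h).symm, (Q.third_ne_right h).symm, rfl⟩

theorem sum_triple {A : Type*} [AddCommMonoid A] (h : x ≠ y) (w : V → A) :
    ∑ z ∈ Q.triple x y, w z = w x + (w y + w (Q.third x y)) := by
  rw [triple, Finset.sum_insert (by simp [h, (Q.third_ne_left h).symm]),
    Finset.sum_pair (Q.third_ne_right h).symm]

theorem triple_eq_triple {a b : V} (hxy : x ≠ y) (hx : x ∈ Q.triple a b)
    (hy : y ∈ Q.triple a b) : Q.triple a b = Q.triple x y := by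
  have hleft := Q.third_third a b
  have hright := Q.third_third_right a b
  have hcomm := Q.third_comm
  ext z
  simp only [mem_triple] at hx hy ⊢
  grind

variable [Fintype V]

/-- The Steiner triple system of a Steiner quasigroup. -/
def toSteinerTripleSystem : SteinerTripleSystem V where
  triples := (Finset.univ : Finset V).offDiag.image fun p ↦ Q.triple p.1 p.2
  card_eq_three := by
    intro t ht
    obtain ⟨p, hp, rfl⟩ := Finset.mem_image.1 ht
    exact Q.card_triple (Finset.mem_offDiag.1 hp).2.2
  existsUnique_triple := by
    intro x y hxy
    refine ⟨Q.triple x y, ⟨Finset.mem_image.2 ⟨(x, y), by simpa using hxy, rfl⟩, by simp [triple],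
      by simp [triple]⟩, ?_⟩
    rintro t ⟨ht, hx, hy⟩
    obtain ⟨p, -, rfl⟩ := Finset.mem_image.1 ht
    exact Q.triple_eq_triple hxy hx hy

theorem mem_triples {t : Finset V} :
    t ∈ Q.toSteinerTripleSystem.triples ↔ ∃ x y, x ≠ y ∧ t = Q.triple x y := by
  simp [toSteinerTripleSystem, eq_comm]

theorem exists_eq_triple_of_mem {t : Finset V} (ht : t ∈ Q.toSteinerTripleSystem.triples)
    (hx : x ∈ t) : ∃ y, x ≠ y ∧ t = Q.triple x y := by
  obtain ⟨a, b, hab, rfl⟩ := Q.mem_triples.1 ht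
  rcases eq_or_ne x a with rfl | hxa
  · exact ⟨b, hab, rfl⟩
  · exact ⟨a, hxa, Q.triple_eq_triple hxa hx (by simp [triple])⟩

end SteinerQuasigroup

/-- An idempotent commutative quasigroup with its left division, the input of Bose's construction of
Steiner triple systems. -/
structure IdempotentCommQuasigroup (Q : Type*) where
  op : Q → Q → Q
  ldiv : Q → Q → Q
  op_self : ∀ x, op x x = x
  op_comm : ∀ x y, op x y = op y x
  op_ldiv : ∀ x y, op x (ldiv x y) = y
  ldiv_op : ∀ x y, ldiv x (op x y) = y

namespace IdempotentCommQuasigroup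

section Bose

theorem eq_or_eq_add_one_or_eq_add_one (i j : ZMod 3) : i = j ∨ j = i + 1 ∨ i = j + 1 := by
  decide +revert

variable {Q : Type*} (B : IdempotentCommQuasigroup Q) {x y : Q}

theorem ldiv_self (x : Q) : B.ldiv x x = x := by
  simpa only [B.op_self] using B.ldiv_op x x

theorem ldiv_ldiv (x y : Q) : B.ldiv (B.ldiv y x) x = y := by
  simpa only [B.op_comm _ y, B.op_ldiv] using B.ldiv_op (B.ldiv y x) y

theorem ldiv_ne_left (h : x ≠ y) : B.ldiv x y ≠ x := fun h' ↦
  h (by simpa only [h', B.op_self] using B.op_ldiv x y)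

theorem ldiv_ne_right (h : x ≠ y) : B.ldiv x y ≠ y := fun h' ↦
  h (by simpa only [h', B.ldiv_self] using (B.ldiv_ldiv y x).symm)

theorem op_ne_left (h : x ≠ y) : B.op x y ≠ x := fun h' ↦
  h (by simpa only [h', B.ldiv_self] using B.ldiv_op x y)

variable [DecidableEq Q]

/-- The third point of a triple of the Bose construction. The triples are `{x} × ZMod 3` and
`{(x, i), (y, i), (op x y, i + 1)}` for `x ≠ y`. -/
def boseThird (p q : Q × ZMod 3) : Q × ZMod 3 :=
  if p.1 = q.1 then (p.1, -(p.2 + q.2))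
  else if p.2 = q.2 then (B.op p.1 q.1, p.2 + 1)
  else if q.2 = p.2 + 1 then (B.ldiv p.1 q.1, p.2)
  else (B.ldiv q.1 p.1, q.2)

theorem boseThird_same_fst (x : Q) (i j : ZMod 3) :
    B.boseThird (x, i) (x, j) = (x, -(i + j)) := by
  simp [boseThird]

theorem boseThird_same_snd (h : x ≠ y) (i : ZMod 3) :
    B.boseThird (x, i) (y, i) = (B.op x y, i + 1) := by
  simp [boseThird, h]

theorem boseThird_succ_right (h : x ≠ y) (i : ZMod 3) :
    B.boseThird (x, i) (y, i + 1) = (B.ldiv x y, i) := by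
  simp [boseThird, h]

theorem boseThird_succ_left (h : x ≠ y) (i : ZMod 3) :
    B.boseThird (x, i + 1) (y, i) = (B.ldiv y x, i) := by
  have : i ≠ i + 1 + 1 := by decide +revert
  simp [boseThird, h, this]

/-- The Bose construction. -/
def bose : SteinerQuasigroup (Q × ZMod 3) where
  third := B.boseThird
  third_self := fun ⟨x, i⟩ ↦ by
    rw [boseThird_same_fst, show -(i + i) = i by decide +revert]
  third_comm := by
    rintro ⟨x, i⟩ ⟨y, j⟩
    rcases eq_or_ne x y with rfl | h
    · simp only [boseThird_same_fst, add_comm]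
    rcases eq_or_eq_add_one_or_eq_add_one i j with rfl | rfl | rfl
    · simp only [B.boseThird_same_snd h, B.boseThird_same_snd h.symm, B.op_comm]
    · rw [B.boseThird_succ_right h, B.boseThird_succ_left h.symm]
    · rw [B.boseThird_succ_left h, B.boseThird_succ_right h.symm]
  third_third := by
    rintro ⟨x, i⟩ ⟨y, j⟩
    rcases eq_or_ne x y with rfl | h
    · simp [boseThird_same_fst]
    rcases eq_or_eq_add_one_or_eq_add_one i j with rfl | rfl | rfl
    · rw [B.boseThird_same_snd h, B.boseThird_succ_right (B.op_ne_left h).symm, B.ldiv_op]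
    · rw [B.boseThird_succ_right h, B.boseThird_same_snd (B.ldiv_ne_left h).symm, B.op_ldiv]
    · rw [B.boseThird_succ_left h, B.boseThird_succ_left (B.ldiv_ne_right h.symm).symm, B.ldiv_ldiv]

variable [Fintype Q]

variable (Q) in
/-- The vertical triples `{x} × ZMod 3` of the Bose construction. -/
def vertical : Finset (Finset (Q × ZMod 3)) :=
  Finset.univ.image fun x ↦ {x} ×ˢ Finset.univ

theorem card_vertical_le : (vertical Q).card ≤ Fintype.card Q :=
  Finset.card_image_le

theorem triple_mem_vertical_iff {p q : Q × ZMod 3} (h : p ≠ q) :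
    B.bose.triple p q ∈ vertical Q ↔ p.1 = q.1 := by
  simp only [vertical, Finset.mem_image, Finset.mem_univ, true_and]
  constructor
  · rintro ⟨x, hx⟩
    have hfst : ∀ r ∈ B.bose.triple p q, r.1 = x := fun r hr ↦
      Finset.mem_singleton.1 (Finset.mem_product.1 (hx.symm ▸ hr)).1
    rw [hfst p (by simp [SteinerQuasigroup.triple]), hfst q (by simp [SteinerQuasigroup.triple])]
  · intro hpq
    refine ⟨p.1, (Finset.eq_of_subset_of_card_le (fun r hr ↦ ?_) ?_).symm⟩
    · rw [Finset.mem_product, Finset.mem_singleton]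
      refine ⟨?_, Finset.mem_univ _⟩
      rcases B.bose.mem_triple.1 hr with rfl | rfl | rfl
      · rfl
      · exact hpq.symm
      · simp [bose, boseThird, hpq]
    · simp [B.bose.card_triple h, ZMod.card]

theorem exists_of_mem_triples {t : Finset (Q × ZMod 3)}
    (ht : t ∈ B.bose.toSteinerTripleSystem.triples) (hv : t ∉ vertical Q) :
    ∃ x y i, x ≠ y ∧ t = B.bose.triple (x, i) (y, i) := by
  obtain ⟨⟨x, i⟩, ⟨y, j⟩, hpq, rfl⟩ := B.bose.mem_triples.1 ht
  have hxy : x ≠ y := mt (B.triple_mem_vertical_iff hpq).2 hv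
  rcases eq_or_eq_add_one_or_eq_add_one i j with rfl | rfl | rfl
  · exact ⟨x, y, i, hxy, rfl⟩
  · refine ⟨x, B.ldiv x y, i, (B.ldiv_ne_left hxy).symm, B.bose.triple_eq_triple ?_ ?_ ?_⟩
    · simpa using (B.ldiv_ne_left hxy).symm
    · simp [SteinerQuasigroup.triple]
    · simp [SteinerQuasigroup.mem_triple, bose, B.boseThird_succ_right hxy]
  · refine ⟨y, B.ldiv y x, j, (B.ldiv_ne_left hxy.symm).symm, B.bose.triple_eq_triple ?_ ?_ ?_⟩
    · simpa using (B.ldiv_ne_left hxy.symm).symm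
    · simp [SteinerQuasigroup.triple]
    · simp [SteinerQuasigroup.mem_triple, bose, B.boseThird_succ_left hxy]

variable {P : Finset (Finset (Q × ZMod 3))}

theorem card_vertical_inter_modEq (hP : B.bose.toSteinerTripleSystem.IsParallelClass P) :
    (vertical Q ∩ P).card ≡ Fintype.card Q [MOD 3] := by
  have hvertical : ∀ t ∈ vertical Q, ∑ p ∈ t, p.2 = 0 := by
    intro t ht
    obtain ⟨x, -, rfl⟩ := Finset.mem_image.1 ht
    rw [Finset.sum_product, Finset.sum_singleton]
    rfl
  have hthree : ∀ i : ZMod 3, i + i + i = 0 := by decide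
  have hmixed : ∀ t ∈ P \ vertical Q, ∑ p ∈ t, p.2 = 1 := by
    intro t ht
    obtain ⟨htP, htv⟩ := Finset.mem_sdiff.1 ht
    obtain ⟨x, y, i, hxy, rfl⟩ := B.exists_of_mem_triples (hP.1.1 htP) htv
    rw [B.bose.sum_triple (by simpa using hxy)]
    simp only [bose, B.boseThird_same_snd hxy]
    rw [← add_assoc, ← add_assoc, hthree, zero_add]
  have hdvd : 3 ∣ (P \ vertical Q).card := by
    rw [← ZMod.natCast_eq_zero_iff]
    calc ((P \ vertical Q).card : ZMod 3) = ∑ t ∈ P \ vertical Q, ∑ p ∈ t, p.2 := by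
          rw [Finset.sum_congr rfl hmixed, Finset.sum_const, nsmul_one]
      _ = ∑ t ∈ P, ∑ p ∈ t, p.2 := by
          rw [← Finset.sum_inter_add_sum_sdiff P (vertical Q), Finset.sum_eq_zero fun t ht ↦
            hvertical t (Finset.mem_inter.1 ht).2, zero_add]
      _ = ∑ _x : Q, ∑ i : ZMod 3, i := by rw [hP.sum_sum, Fintype.sum_prod_type]
      _ = 0 := Finset.sum_eq_zero fun _ _ ↦ rfl
  have hcard := hP.three_mul_card
  have hsplit := Finset.card_inter_add_card_sdiff P (vertical Q)
  rw [Fintype.card_prod, ZMod.card] at hcard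
  rw [Finset.inter_comm, Nat.ModEq]
  omega

theorem le_chromaticIndex_bose {k : ℕ} (hQ : Fintype.card Q = 2 * k + 1)
    (h : ∀ P, B.bose.toSteinerTripleSystem.IsParallelClass P → 2 ≤ (vertical Q ∩ P).card) :
    3 * k + 3 ≤ B.bose.toSteinerTripleSystem.chromaticIndex := by
  refine SteinerTripleSystem.le_chromaticIndex (r := 2) ?_ (vertical Q) ?_ h
  · simp [hQ, ZMod.card]
    omega
  · have := card_vertical_le (Q := Q)
    omega

end Bose

/-- The midpoint quasigroup `x, y ↦ (x + y) / 2` of a ring in which `2` is invertible. -/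
def midpoint (R : Type*) [CommRing R] [Invertible (2 : R)] : IdempotentCommQuasigroup R where
  op x y := ⅟2 * (x + y)
  ldiv x y := 2 * y - x
  op_self x := by rw [← two_mul, invOf_mul_cancel_left]
  op_comm x y := by rw [add_comm]
  op_ldiv x y := by rw [add_sub_cancel, invOf_mul_cancel_left]
  ldiv_op x y := by rw [mul_invOf_cancel_left, add_sub_cancel_left]

end IdempotentCommQuasigroup

namespace SteinerQuasigroup

/-- A Steiner quasigroup as an idempotent commutative quasigroup: it is its own left division. -/
def toIdempotentCommQuasigroup {V : Type*} (Q : SteinerQuasigroup V) :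
    IdempotentCommQuasigroup V where
  op := Q.third
  ldiv := Q.third
  op_self := Q.third_self
  op_comm := Q.third_comm
  op_ldiv := Q.third_third
  ldiv_op := Q.third_third

section Projective

variable {A : Type*} [AddCommGroup A] [DecidableEq A]

/-- The projective Steiner quasigroup on the nonzero elements of an elementary abelian `2`-group,
whose triples are the `{x, y, x + y}`. -/
def projective (h : ∀ x : A, x + x = 0) : SteinerQuasigroup {x : A // x ≠ 0} where
  third x y := if hxy : x = y then x else
    ⟨x + y, fun h0 ↦ hxy (Subtype.ext ((eq_neg_of_add_eq_zero_left h0).trans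
      (eq_neg_of_add_eq_zero_left (h y)).symm))⟩
  third_self x := by simp
  third_comm x y := by
    by_cases hxy : x = y
    · rw [hxy]
    · simp [hxy, Ne.symm hxy, add_comm]
  third_third x y := by
    by_cases hxy : x = y
    · simp [hxy]
    · have hy : (x : A) ≠ x + y := by simpa [eq_comm] using y.2
      simp [hxy, Subtype.ext_iff, hy, ← add_assoc, h]

theorem coe_projective_third (h : ∀ x : A, x + x = 0) {x y : {x : A // x ≠ 0}} (hxy : x ≠ y) :
    ((projective h).third x y : A) = x + y := by
  simp [projective, hxy]

open IdempotentCommQuasigroup in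
theorem card_vertical_inter_ne_one [Fintype A] (h : ∀ x : A, x + x = 0)
    (hsum : ∑ x : {x : A // x ≠ 0}, (x : A) = 0)
    {P : Finset (Finset ({x : A // x ≠ 0} × ZMod 3))}
    (hP : (projective h).toIdempotentCommQuasigroup.bose.toSteinerTripleSystem.IsParallelClass P) :
    (vertical {x : A // x ≠ 0} ∩ P).card ≠ 1 := by
  set B := (projective h).toIdempotentCommQuasigroup
  intro hone
  obtain ⟨t, ht⟩ := Finset.card_eq_one.1 hone
  obtain ⟨htv, htP⟩ := Finset.mem_inter.1 (ht.symm ▸ Finset.mem_singleton_self t)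
  have hmixed : ∀ s ∈ P, s ≠ t → ∑ p ∈ s, (p.1 : A) = 0 := by
    intro s hs hst
    have hsv : s ∉ vertical {x : A // x ≠ 0} := fun hsv ↦
      hst (Finset.mem_singleton.1 (ht ▸ Finset.mem_inter.2 ⟨hsv, hs⟩))
    obtain ⟨x, y, i, hxy, rfl⟩ := B.exists_of_mem_triples (hP.1.1 hs) hsv
    rw [B.bose.sum_triple (by simpa using hxy)]
    simp only [bose, B.boseThird_same_snd hxy]
    rw [show B.op x y = (projective h).third x y from rfl, coe_projective_third h hxy, ← add_assoc,
      h]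
  obtain ⟨x, -, rfl⟩ := Finset.mem_image.1 htv
  have hthree : ∀ y : A, 3 • y = y := fun y ↦ by
    rw [show 3 = 2 + 1 from rfl, add_nsmul, two_nsmul, h, zero_add, one_nsmul]
  have htotal : (x : A) = ∑ x : {x : A // x ≠ 0}, (x : A) := by
    simpa [Finset.sum_product, Fintype.sum_prod_type, ZMod.card, hthree,
      Finset.sum_eq_single_of_mem _ htP hmixed] using hP.sum_sum fun p ↦ (p.1 : A)
  exact x.2 (htotal.trans hsum)

end Projective

end SteinerQuasigroup

namespace SteinerTripleSystem

theorem exists_le_two_mul_chromaticIndex_of_mod_eq_fifteen {v : ℕ} (hv : v % 18 = 15) :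
    ∃ S : SteinerTripleSystem (Fin v), v + 3 ≤ 2 * S.chromaticIndex := by
  obtain ⟨j, rfl⟩ : ∃ j, v = 3 * (6 * j + 5) := ⟨v / 18, by omega⟩
  have : NeZero (6 * j + 5) := ⟨by omega⟩
  have : Invertible (2 : ZMod (6 * j + 5)) :=
    ((ZMod.isUnit_iff_coprime 2 _).2 <| by
      rw [Nat.coprime_two_left, Nat.odd_iff]; omega).invertible
  let B := IdempotentCommQuasigroup.midpoint (ZMod (6 * j + 5))
  obtain ⟨S, hS⟩ := exists_fin_chromaticIndex_le B.bose.toSteinerTripleSystem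
    (v := 3 * (6 * j + 5)) (by simp [ZMod.card, mul_comm])
  have hB := B.le_chromaticIndex_bose (k := 3 * j + 2) (by rw [ZMod.card]; ring) fun P hP ↦ by
    have := B.card_vertical_inter_modEq hP
    rw [ZMod.card, Nat.ModEq] at this
    omega
  exact ⟨S, by omega⟩

theorem exists_le_two_mul_chromaticIndex_twentyOne :
    ∃ S : SteinerTripleSystem (Fin 21), 21 + 3 ≤ 2 * S.chromaticIndex := by
  have hself : ∀ x : Fin 3 → ZMod 2, x + x = 0 := by decide
  have hcard : Fintype.card {x : Fin 3 → ZMod 2 // x ≠ 0} = 7 := by decide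
  let B := (SteinerQuasigroup.projective hself).toIdempotentCommQuasigroup
  obtain ⟨S, hS⟩ := exists_fin_chromaticIndex_le B.bose.toSteinerTripleSystem
    (v := 21) (by simp [hcard, ZMod.card])
  have hB := B.le_chromaticIndex_bose (k := 3) hcard fun P hP ↦ by
    have hmod := B.card_vertical_inter_modEq hP
    have hone := SteinerQuasigroup.card_vertical_inter_ne_one hself (by decide) hP
    rw [hcard, Nat.ModEq] at hmod
    omega
  exact ⟨S, by omega⟩

end SteinerTripleSystem

theorem mul_ne_zero_of_invertible {M : Type*} [MonoidWithZero M] (a : M) [Invertible a] {x : M}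
    (hx : x ≠ 0) : a * x ≠ 0 :=
  mt (isUnit_of_invertible a).mul_right_eq_zero.1 hx

/-- A colouring of the elements of a ring by `ZMod 3` that separates every nonzero `x` from `2 * x`.
It encodes a proper edge colouring, with `x` standing for the edge `{x, -2x}`, of the cubic graph on
the nonzero elements in which `x` is adjacent to `-x`, `-2x` and `-x/2`: at each vertex the third
colour goes to the edge `{x, -x}`. -/
structure DoublingColoring (R : Type*) [CommRing R] where
  color : R → ZMod 3
  color_neg : ∀ x, color (-x) = color x
  color_two_mul_ne : ∀ x, x ≠ 0 → color (2 * x) ≠ color x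

namespace DoublingColoring

variable {R : Type*} [CommRing R] [Invertible (2 : R)] (C : DoublingColoring R)
  {x y : {x : R // x ≠ 0}} {i : ZMod 3}

theorem color_half_ne (x : {x : R // x ≠ 0}) : C.color (⅟2 * x) ≠ C.color x := by
  simpa [eq_comm] using C.color_two_mul_ne _ (mul_ne_zero_of_invertible ⅟2 x.2)

/-- The neighbour of `x` along the edge of colour `i`. -/
def partner (i : ZMod 3) (x : {x : R // x ≠ 0}) : {x : R // x ≠ 0} :=
  ⟨if C.color x = i then -(2 * x) else if C.color (⅟2 * x) = i then -(⅟2 * x) else -x, by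
    have h2 := mul_ne_zero_of_invertible 2 x.2
    have hhalf := mul_ne_zero_of_invertible ⅟2 x.2
    split_ifs
    · exact neg_ne_zero.2 h2
    · exact neg_ne_zero.2 hhalf
    · exact neg_ne_zero.2 x.2⟩

theorem coe_partner_of_color (h : C.color x = i) : (C.partner i x : R) = -(2 * x) := by
  simp [partner, h]

theorem coe_partner_of_color_half (h : C.color (⅟2 * x) = i) :
    (C.partner i x : R) = -(⅟2 * x) := by
  subst h
  simp [partner, (C.color_half_ne x).symm]

theorem coe_partner_of_ne (h : C.color x ≠ i) (h' : C.color (⅟2 * x) ≠ i) :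
    (C.partner i x : R) = -x := by
  simp [partner, h, h']

theorem partner_partner (i : ZMod 3) (x : {x : R // x ≠ 0}) :
    C.partner i (C.partner i x) = x := by
  apply Subtype.ext
  by_cases hx : C.color x = i
  · have hy := C.coe_partner_of_color hx
    rw [C.coe_partner_of_color_half (by simpa [hy, C.color_neg] using hx), hy]
    simp
  by_cases hx' : C.color (⅟2 * x) = i
  · have hy := C.coe_partner_of_color_half hx'
    rw [C.coe_partner_of_color (by rwa [hy, C.color_neg]), hy]
    simp
  · have hy := C.coe_partner_of_ne hx hx'
    rw [C.coe_partner_of_ne (by rwa [hy, C.color_neg]) (by rwa [hy, mul_neg, C.color_neg]), hy,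
      neg_neg]

theorem exists_partner_eq_iff :
    (∃ i, C.partner i x = y) ↔ (y : R) = -x ∨ (y : R) = -(2 * x) ∨ (x : R) = -(2 * y) := by
  have hhalf : (x : R) = -(2 * y) ↔ (y : R) = -(⅟2 * x) := by
    constructor
    · intro h
      simp [h]
    · intro h
      simp [h]
  simp only [Subtype.ext_iff, hhalf]
  constructor
  · rintro ⟨i, hi⟩
    rw [← hi]
    simp only [partner]
    split_ifs <;> simp
  · rintro (h | h | h)
    · obtain ⟨i, hi, hi'⟩ : ∃ i, C.color x ≠ i ∧ C.color (⅟2 * x) ≠ i := by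
        generalize C.color x = a, C.color (⅟2 * x) = b
        decide +revert
      exact ⟨i, (C.coe_partner_of_ne hi hi').trans h.symm⟩
    · exact ⟨_, (C.coe_partner_of_color rfl).trans h.symm⟩
    · exact ⟨_, (C.coe_partner_of_color_half rfl).trans h.symm⟩

theorem exists_partner_eq_comm : (∃ i, C.partner i x = y) ↔ ∃ i, C.partner i y = x :=
  exists_congr fun i ↦
    ⟨fun h ↦ h ▸ C.partner_partner i x, fun h ↦ h ▸ C.partner_partner i y⟩

theorem add_ne_zero_of_not_partner (h : ¬∃ i, C.partner i x = y) : -(x + y : R) ≠ 0 := by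
  rw [exists_partner_eq_iff] at h
  grind

theorem not_partner_neg_add (h : ¬∃ i, C.partner i x = y) (hxy : x ≠ y) :
    ¬∃ i, C.partner i x = ⟨-(x + y), C.add_ne_zero_of_not_partner h⟩ := by
  have hy := y.2
  rw [exists_partner_eq_iff] at h ⊢
  rw [Ne, Subtype.ext_iff] at hxy
  simp only
  grind

theorem ne_neg_add_of_not_partner (h : ¬∃ i, C.partner i x = y) :
    x ≠ ⟨-(x + y), C.add_ne_zero_of_not_partner h⟩ := by
  rw [exists_partner_eq_iff] at h
  rw [Ne, Subtype.ext_iff]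
  simp only
  grind

open Classical in
/-- The third point of a triple of the Schreiber–Wilson construction, in which `ZMod 3` is a triple
of ideal points, each ideal point `i` forms triples with the edges of colour `i`, and the remaining
triples are the zero-sum triples of distinct nonzero ring elements. -/
noncomputable def schreiberWilsonThird :
    ZMod 3 ⊕ {x : R // x ≠ 0} → ZMod 3 ⊕ {x : R // x ≠ 0} → ZMod 3 ⊕ {x : R // x ≠ 0}
  | .inl i, .inl j => .inl (-(i + j))
  | .inl i, .inr x => .inr (C.partner i x)
  | .inr x, .inl i => .inr (C.partner i x)
  | .inr x, .inr y =>
    if h : ∃ i, C.partner i x = y then .inl h.choose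
    else if x = y then .inr x
    else .inr ⟨-(x + y), C.add_ne_zero_of_not_partner h⟩

theorem schreiberWilsonThird_of_not_partner (h : ¬∃ i, C.partner i x = y) (hxy : x ≠ y) :
    C.schreiberWilsonThird (.inr x) (.inr y) =
      .inr ⟨-(x + y), C.add_ne_zero_of_not_partner h⟩ := by
  rw [schreiberWilsonThird, dif_neg h, if_neg hxy]

section Quasigroup

variable [Invertible (3 : R)]

theorem partner_injective (x : {x : R // x ≠ 0}) :
    Function.Injective fun i ↦ C.partner i x := by
  intro i j hij
  have hx := x.2
  have h2 : 2 * ⅟2 = (1 : R) := mul_invOf_self 2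
  have h3x := mul_ne_zero_of_invertible 3 x.2
  have hhalf := mul_ne_zero_of_invertible ⅟2 x.2
  have hthird : ∀ a b i j : ZMod 3, a ≠ b → a ≠ i → b ≠ i → a ≠ j → b ≠ j → i = j := by decide
  have := hthird _ _ i j (C.color_half_ne x).symm
  rw [Subtype.ext_iff] at hij
  simp only [partner] at hij
  grind

theorem partner_ne (i : ZMod 3) (x : {x : R // x ≠ 0}) : C.partner i x ≠ x := by
  intro h
  have h2x := mul_ne_zero_of_invertible 2 x.2
  have h3x := mul_ne_zero_of_invertible 3 x.2
  have := C.exists_partner_eq_iff.1 ⟨i, h⟩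
  grind

theorem schreiberWilsonThird_partner (i : ZMod 3) (x : {x : R // x ≠ 0}) :
    C.schreiberWilsonThird (.inr x) (.inr (C.partner i x)) = .inl i := by
  have h : ∃ j, C.partner j x = C.partner i x := ⟨i, rfl⟩
  rw [schreiberWilsonThird, dif_pos h, C.partner_injective x h.choose_spec]

theorem schreiberWilsonThird_self (x : {x : R // x ≠ 0}) :
    C.schreiberWilsonThird (.inr x) (.inr x) = .inr x := by
  simp [schreiberWilsonThird, C.partner_ne]

/-- The Schreiber–Wilson construction. -/
noncomputable def schreiberWilson : SteinerQuasigroup (ZMod 3 ⊕ {x : R // x ≠ 0}) where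
  third := C.schreiberWilsonThird
  third_self := by
    rintro (i | x)
    · exact congrArg Sum.inl (by decide +revert)
    · exact C.schreiberWilsonThird_self x
  third_comm := by
    rintro (i | x) (j | y)
    · exact congrArg Sum.inl (by rw [add_comm])
    · rfl
    · rfl
    by_cases h : ∃ i, C.partner i x = y
    · obtain ⟨i, rfl⟩ := h
      nth_rw 4 [← C.partner_partner i x]
      rw [schreiberWilsonThird_partner, schreiberWilsonThird_partner]
    · rcases eq_or_ne x y with rfl | hxy
      · rfl
      · rw [C.schreiberWilsonThird_of_not_partner h hxy,
          C.schreiberWilsonThird_of_not_partner (mt C.exists_partner_eq_comm.1 h) hxy.symm]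
        simp only [add_comm]
  third_third := by
    rintro (i | x) (j | y)
    · exact congrArg Sum.inl (by ring)
    · exact congrArg Sum.inr (C.partner_partner i y)
    · exact C.schreiberWilsonThird_partner j x
    by_cases h : ∃ i, C.partner i x = y
    · obtain ⟨i, rfl⟩ := h
      rw [schreiberWilsonThird_partner]
      rfl
    · rcases eq_or_ne x y with rfl | hxy
      · rw [schreiberWilsonThird_self, schreiberWilsonThird_self]
      · rw [C.schreiberWilsonThird_of_not_partner h hxy,
          C.schreiberWilsonThird_of_not_partner (C.not_partner_neg_add h hxy)
            (C.ne_neg_add_of_not_partner h)]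
        simp

end Quasigroup

section Weight

variable [DecidableEq R]

/-- The weight for which all triples without ideal points have sum zero. -/
def weight : ZMod 3 ⊕ {x : R // x ≠ 0} → R := Sum.elim 0 Subtype.val

theorem sum_weight [Fintype R] : ∑ p : ZMod 3 ⊕ {x : R // x ≠ 0}, weight p = 0 := by
  have hinv : Function.Involutive fun x : {x : R // x ≠ 0} ↦
      (⟨-x, neg_ne_zero.2 x.2⟩ : {x : R // x ≠ 0}) := fun x ↦ by simp
  have hneg : ∑ x : {x : R // x ≠ 0}, (x : R) = ∑ x : {x : R // x ≠ 0}, -(x : R) :=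
    Fintype.sum_bijective _ hinv.bijective _ _ fun x ↦ by simp
  rw [Finset.sum_neg_distrib, eq_neg_iff_add_eq_zero, ← two_mul,
    (isUnit_of_invertible (2 : R)).mul_right_eq_zero] at hneg
  simpa [weight] using hneg

variable [Invertible (3 : R)]

/-- The triple of the ideal points. -/
noncomputable def idealTriple : Finset (ZMod 3 ⊕ {x : R // x ≠ 0}) :=
  C.schreiberWilson.triple (.inl 0) (.inl 1)

/-- The triple formed by the ideal point `i` and the edge of colour `i` at `x`. -/
noncomputable def edgeTriple (i : ZMod 3) (x : {x : R // x ≠ 0}) :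
    Finset (ZMod 3 ⊕ {x : R // x ≠ 0}) :=
  C.schreiberWilson.triple (.inl i) (.inr x)

theorem edgeTriple_eq (i : ZMod 3) (x : {x : R // x ≠ 0}) :
    C.edgeTriple i x = {.inl i, .inr x, .inr (C.partner i x)} := rfl

theorem edgeTriple_partner (i : ZMod 3) (x : {x : R // x ≠ 0}) :
    C.edgeTriple i (C.partner i x) = C.edgeTriple i x := by
  simp [edgeTriple_eq, C.partner_partner, Finset.pair_comm]

theorem sum_weight_edgeTriple (i : ZMod 3) (x : {x : R // x ≠ 0}) :
    ∑ p ∈ C.edgeTriple i x, weight p = x + C.partner i x := by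
  rw [edgeTriple, SteinerQuasigroup.sum_triple _ (by simp)]
  simp [weight, schreiberWilson, schreiberWilsonThird]

theorem partner_eq_neg_or_exists_edgeTriple_eq (i : ZMod 3) (x : {x : R // x ≠ 0}) :
    (C.partner i x : R) = -x ∧ C.color x ≠ i ∧ C.color (⅟2 * x) ≠ i ∨
      ∃ y : {x : R // x ≠ 0}, C.color y = i ∧ C.edgeTriple i x = C.edgeTriple i y ∧
        (x + C.partner i x : R) = -y := by
  by_cases hx : C.color x = i
  · refine .inr ⟨x, hx, rfl, ?_⟩
    rw [C.coe_partner_of_color hx]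
    ring
  by_cases hx' : C.color (⅟2 * x) = i
  · have hy := C.coe_partner_of_color_half hx'
    refine .inr ⟨C.partner i x, by rwa [hy, C.color_neg], (C.edgeTriple_partner i x).symm, ?_⟩
    have h := C.coe_partner_of_color (x := C.partner i x) (i := i) (by rwa [hy, C.color_neg])
    rw [C.partner_partner] at h
    linear_combination h
  · exact .inl ⟨C.coe_partner_of_ne hx hx', hx, hx'⟩

variable [Fintype R] {t : Finset (ZMod 3 ⊕ {x : R // x ≠ 0})}

theorem eq_idealTriple_or_exists_eq_edgeTriple
    (ht : t ∈ C.schreiberWilson.toSteinerTripleSystem.triples) (hi : .inl i ∈ t) :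
    t = C.idealTriple ∨ ∃ x, t = C.edgeTriple i x := by
  obtain ⟨j | x, hy, rfl⟩ := C.schreiberWilson.exists_eq_triple_of_mem ht hi
  · left
    have hthird : ∀ i j l : ZMod 3, i ≠ j → l = i ∨ l = j ∨ l = -(i + j) := by decide
    have hmem : ∀ l : ZMod 3, .inl l ∈ C.schreiberWilson.triple (.inl i) (.inl j) := fun l ↦ by
      simpa [SteinerQuasigroup.mem_triple, schreiberWilson, schreiberWilsonThird] using
        hthird i j l (by simpa using hy)
    exact C.schreiberWilson.triple_eq_triple (by simp) (hmem 0) (hmem 1)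
  · exact .inr ⟨x, rfl⟩

theorem sum_weight_eq_zero (ht : t ∈ C.schreiberWilson.toSteinerTripleSystem.triples)
    (hi : ∀ i, .inl i ∉ t) : ∑ p ∈ t, weight p = 0 := by
  obtain ⟨p, q, hpq, rfl⟩ := C.schreiberWilson.mem_triples.1 ht
  rcases p with i | x
  · exact absurd (by simp [SteinerQuasigroup.triple]) (hi i)
  rcases q with j | y
  · exact absurd (by simp [SteinerQuasigroup.triple]) (hi j)
  have hxy : x ≠ y := by simpa using hpq
  have h : ¬∃ i, C.partner i x = y := by
    rintro ⟨i, rfl⟩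
    exact hi i (C.schreiberWilson.mem_triple.2
      (.inr (.inr (C.schreiberWilsonThird_partner i x).symm)))
  rw [C.schreiberWilson.sum_triple hpq]
  simp only [schreiberWilson, C.schreiberWilsonThird_of_not_partner h hxy, weight, Sum.elim_inr]
  ring

theorem exists_edgeTriple_mem_of_idealTriple_notMem
    {P : Finset (Finset (ZMod 3 ⊕ {x : R // x ≠ 0}))}
    (hP : C.schreiberWilson.toSteinerTripleSystem.IsParallelClass P) (hideal : C.idealTriple ∉ P) :
    ∃ x : ZMod 3 → {x : R // x ≠ 0}, (∀ i, C.edgeTriple i (x i) ∈ P) ∧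
      ∑ i, ((x i : R) + C.partner i (x i)) = 0 := by
  have hedge : ∀ i, ∃ x, C.edgeTriple i x ∈ P := fun i ↦ by
    obtain ⟨t, ht, hit⟩ := hP.2 (.inl i)
    rcases C.eq_idealTriple_or_exists_eq_edgeTriple (hP.1.1 ht) hit with rfl | ⟨x, rfl⟩
    · exact absurd ht hideal
    · exact ⟨x, ht⟩
  choose x hx using hedge
  refine ⟨x, hx, ?_⟩
  have hinj : Function.Injective fun i ↦ C.edgeTriple i (x i) := fun i j hij ↦ by
    have hi : .inl i ∈ C.edgeTriple j (x j) := by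
      rw [← show C.edgeTriple i (x i) = C.edgeTriple j (x j) from hij]
      simp [edgeTriple_eq]
    simpa [edgeTriple_eq] using hi
  calc ∑ i, ((x i : R) + C.partner i (x i))
      = ∑ t ∈ Finset.univ.image fun i ↦ C.edgeTriple i (x i), ∑ p ∈ t, weight p := by
        rw [Finset.sum_image hinj.injOn]
        exact Finset.sum_congr rfl fun i _ ↦ (C.sum_weight_edgeTriple i (x i)).symm
    _ = ∑ t ∈ P, ∑ p ∈ t, weight p := by
        refine Finset.sum_subset (Finset.image_subset_iff.2 fun i _ ↦ hx i) fun t ht htimage ↦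
          C.sum_weight_eq_zero (hP.1.1 ht) fun i hi ↦ htimage ?_
        rw [hP.eq_of_mem ht (hx i) hi (by simp [edgeTriple_eq])]
        exact Finset.mem_image_of_mem _ (Finset.mem_univ i)
    _ = 0 := by rw [hP.sum_sum, sum_weight]

/-- The nonzero ring elements of colour `0`. -/
def zeros : Finset {x : R // x ≠ 0} := {x | C.color x = 0}

/-- A small set of triples that meets every parallel class: the ideal triple and, for every nonzero
`x` of colour `0`, the triples on the edges `{x, -2x}` and `{x, -x}`. The set `{1, x, -x}` is only a
triple if the edge `{x, -x}` has colour `1`; the criterion for the chromatic index allows it to be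
included in any case. -/
noncomputable def special : Finset (Finset (ZMod 3 ⊕ {x : R // x ≠ 0})) :=
  insert C.idealTriple (C.zeros.image (C.edgeTriple 0) ∪
    C.zeros.image fun x ↦ {.inl 1, .inr x, .inr ⟨-x, neg_ne_zero.2 x.2⟩})

theorem two_mul_card_special_le : 2 * C.special.card ≤ 2 + 3 * C.zeros.card := by
  have hfst : (C.zeros.image (C.edgeTriple 0)).card ≤ C.zeros.card := Finset.card_image_le
  have hsnd := Finset.mul_card_image_le_card C.zeros 2
    (f := fun x ↦ ({.inl 1, .inr x, .inr ⟨-x, neg_ne_zero.2 x.2⟩} :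
      Finset (ZMod 3 ⊕ {x : R // x ≠ 0}))) fun t ht ↦ by
    obtain ⟨x, hx, rfl⟩ := Finset.mem_image.1 ht
    have hne : x ≠ ⟨-x, neg_ne_zero.2 x.2⟩ := fun h ↦ by
      rw [Subtype.ext_iff, eq_neg_iff_add_eq_zero, ← two_mul] at h
      exact mul_ne_zero_of_invertible 2 x.2 h
    rw [← Finset.card_pair hne]
    refine Finset.card_le_card (Finset.insert_subset ?_ (Finset.singleton_subset_iff.2 ?_))
    · simpa using hx
    · simpa [zeros, C.color_neg, Finset.pair_comm] using hx
  have hunion := Finset.card_insert_le C.idealTriple (C.zeros.image (C.edgeTriple 0) ∪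
    C.zeros.image fun x ↦ {.inl 1, .inr x, .inr ⟨-x, neg_ne_zero.2 x.2⟩})
  have := Finset.card_union_le (C.zeros.image (C.edgeTriple 0))
    (C.zeros.image fun x ↦ {.inl 1, .inr x, .inr ⟨-x, neg_ne_zero.2 x.2⟩})
  rw [special]
  omega

theorem add_partner_eq_zero_of_notMem_special {x : {x : R // x ≠ 0}}
    (hx : C.edgeTriple 0 x ∉ C.special) : (x + C.partner 0 x : R) = 0 := by
  rcases C.partner_eq_neg_or_exists_edgeTriple_eq 0 x with ⟨h, -⟩ | ⟨y, hy, heq, -⟩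
  · rw [h, add_neg_cancel]
  · refine absurd (heq ▸ ?_) hx
    simp only [special, Finset.mem_insert, Finset.mem_union]
    exact .inr (.inl (Finset.mem_image_of_mem _ (by simpa [zeros] using hy)))

theorem exists_color_eq_one_of_notMem_special
    (hC : ∀ x ≠ 0, C.color x = 0 → C.color (2 * x) = 1) {x : {x : R // x ≠ 0}}
    (hx : C.edgeTriple 1 x ∉ C.special) :
    ∃ y : {x : R // x ≠ 0}, C.color y = 1 ∧ (x + C.partner 1 x : R) = -y := by
  rcases C.partner_eq_neg_or_exists_edgeTriple_eq 1 x with ⟨h, h1, h1'⟩ | ⟨y, hy, -, heq⟩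
  · have hcolor : C.color x = 0 := by
      have hthird : ∀ a b : ZMod 3, a ≠ 1 → b ≠ 1 → b ≠ a → b ≠ 0 → a = 0 := by decide
      refine hthird _ _ h1 h1' (C.color_half_ne x) fun h0 ↦ h1 ?_
      simpa using hC _ (mul_ne_zero_of_invertible ⅟2 x.2) h0
    refine absurd ?_ hx
    simp only [special, Finset.mem_insert, Finset.mem_union]
    refine .inr (.inr (Finset.mem_image.2 ⟨x, by simpa [zeros] using hcolor, ?_⟩))
    have hneg : C.partner 1 x = ⟨-x, neg_ne_zero.2 x.2⟩ := Subtype.ext h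
    rw [edgeTriple_eq, hneg]
  · exact ⟨y, hy, heq⟩

theorem special_inter_nonempty (hC : ∀ x ≠ 0, C.color x = 0 → C.color (2 * x) = 1)
    {P : Finset (Finset (ZMod 3 ⊕ {x : R // x ≠ 0}))}
    (hP : C.schreiberWilson.toSteinerTripleSystem.IsParallelClass P) :
    (C.special ∩ P).Nonempty := by
  rw [← Finset.not_disjoint_iff_nonempty_inter]
  intro hdisj
  have hnot : ∀ {t}, t ∈ P → t ∉ C.special := fun ht hs ↦ Finset.disjoint_left.1 hdisj hs ht
  obtain ⟨x, hx, hsum⟩ := C.exists_edgeTriple_mem_of_idealTriple_notMem hP fun h ↦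
    hnot h (Finset.mem_insert_self _ _)
  have hzero := C.add_partner_eq_zero_of_notMem_special (hnot (hx 0))
  obtain ⟨y, hy, hsumy⟩ := C.exists_color_eq_one_of_notMem_special hC (hnot (hx 1))
  replace hsum := (Fin.sum_univ_three
    (fun i : Fin 3 ↦ (x i + C.partner i (x i) : R))).symm.trans hsum
  rcases C.partner_eq_neg_or_exists_edgeTriple_eq 2 (x 2) with ⟨h, -⟩ | ⟨z, hz, -, heq⟩
  · exact y.2 (by linear_combination hzero + hsumy + h - hsum)
  · have hyz : (y : R) = -z := by
      linear_combination hzero + hsumy + heq - hsum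
    rw [hyz, C.color_neg, hz] at hy
    exact absurd hy (by decide)

theorem le_chromaticIndex_schreiberWilson
    (hC : ∀ x ≠ 0, C.color x = 0 → C.color (2 * x) = 1) {k : ℕ}
    (hR : Fintype.card R = 6 * k + 1) (hzeros : 3 * C.zeros.card < 2 * k) :
    3 * k + 3 ≤ C.schreiberWilson.toSteinerTripleSystem.chromaticIndex := by
  refine SteinerTripleSystem.le_chromaticIndex (r := 1) ?_ C.special ?_ fun P hP ↦
    (C.special_inter_nonempty hC hP).card_pos
  · rw [Fintype.card_sum, ZMod.card, Fintype.card_subtype_compl, Fintype.card_subtype_eq, hR]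
    omega
  · have := C.two_mul_card_special_le
    omega

end Weight

end DoublingColoring

section PeriodicOrbit

open Function

variable {α : Type*} {f : α → α}

theorem exists_orbitIndex (hf : ∀ x, x ∈ periodicPts f) :
    ∃ idx : α → ℕ,
      (∀ x, idx (f x) = if idx x + 1 = minimalPeriod f x then 0 else idx x + 1) ∧
      ∀ x y, periodicOrbit f x = periodicOrbit f y → idx x = idx y → x = y := by
  let base (x : α) : α := (Quotient.mk (Setoid.ker (periodicOrbit f)) x).out
  have hbase (x : α) : periodicOrbit f (base x) = periodicOrbit f x :=
    Quotient.mk_out (s := Setoid.ker (periodicOrbit f)) x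
  have hbase_congr {x y : α} (h : periodicOrbit f x = periodicOrbit f y) : base x = base y :=
    congrArg Quotient.out (Quotient.sound (s := Setoid.ker (periodicOrbit f)) h)
  have hperiod (x : α) : minimalPeriod f (base x) = minimalPeriod f x := by
    rw [← periodicOrbit_length, hbase, periodicOrbit_length]
  have hidx (x : α) : ∃ i < minimalPeriod f x, f^[i] (base x) = x := by
    obtain ⟨n, hn⟩ := (mem_periodicOrbit_iff (hf (base x))).1
      (hbase x ▸ self_mem_periodicOrbit (hf x))
    exact ⟨n % minimalPeriod f x, Nat.mod_lt _ (minimalPeriod_pos_of_mem_periodicPts (hf x)),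
      by rw [← hperiod, iterate_mod_minimalPeriod_eq, hn]⟩
  choose idx hlt hidx using hidx
  refine ⟨idx, fun x ↦ ?_, fun x y hxy h ↦ ?_⟩
  · have hnext : f^[idx (f x)] (base x) = f^[idx x + 1] (base x) := by
      rw [iterate_succ_apply', hidx x, ← hbase_congr (periodicOrbit_apply_eq (hf x)), hidx]
    have hnext_lt : idx (f x) < minimalPeriod f (base x) := by
      rw [hperiod, ← minimalPeriod_apply (hf x)]
      exact hlt (f x)
    have := hlt x
    have := hperiod x
    split_ifs with h
    · rw [h, ← hperiod, iterate_minimalPeriod] at hnext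
      exact (iterate_eq_iterate_iff_of_lt_minimalPeriod hnext_lt (by omega)).1 hnext
    · exact (iterate_eq_iterate_iff_of_lt_minimalPeriod hnext_lt (by omega)).1 hnext
  · rw [← hidx x, ← hidx y, hbase_congr hxy, h]

theorem exists_orbitColoring (hf : ∀ x, x ∈ periodicPts f) :
    ∃ c : α → ZMod 3, (∀ x, f x ≠ x → c (f x) ≠ c x) ∧ (∀ x, f x ≠ x → c x = 0 → c (f x) = 1) ∧
      (∀ x, c x = 0 → Odd (minimalPeriod f x)) ∧
      ∀ x y, periodicOrbit f x = periodicOrbit f y → c x = 0 → c y = 0 → x = y := by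
  obtain ⟨idx, hsucc, hinj⟩ := exists_orbitIndex hf
  let c (x : α) : ZMod 3 :=
    if idx x + 1 = minimalPeriod f x ∧ Odd (minimalPeriod f x) then 0
    else if Even (idx x) then 1 else 2
  have hzero (x : α) : c x = 0 ↔ idx x + 1 = minimalPeriod f x ∧ Odd (minimalPeriod f x) := by
    have : (2 : ZMod 3) ≠ 0 := by decide
    grind
  have happly (x : α) (hx : f x ≠ x) : c x ≠ c (f x) ∧ (c x = 0 → c (f x) = 1) := by
    have hperiod := minimalPeriod_apply (hf x)
    have hone : minimalPeriod f x ≠ 1 := mt minimalPeriod_eq_one_iff_isFixedPt.1 hx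
    have h01 : (0 : ZMod 3) ≠ 1 := by decide
    simp only [c, hsucc, hperiod]
    grind
  refine ⟨c, fun x hx ↦ (happly x hx).1.symm, fun x hx ↦ (happly x hx).2,
    fun x hx ↦ ((hzero x).1 hx).2, fun x y hxy hx hy ↦ hinj x y hxy ?_⟩
  have hperiod : minimalPeriod f x = minimalPeriod f y := by
    rw [← periodicOrbit_length, hxy, periodicOrbit_length]
  have := ((hzero x).1 hx).1
  have := ((hzero y).1 hy).1
  omega

end PeriodicOrbit

section Doubling

variable {R : Type*} [CommRing R]

/-- The length of the orbit of `{x, -x}` under multiplication by `2`. -/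
noncomputable def signedPeriod (x : R) : ℕ :=
  Function.minimalPeriod (Sym2.map (2 * ·)) s(x, -x)

/-- Distinct elements of `s` have distinct orbits under multiplication by `2`, unless they are
negatives of each other. -/
def IsDoublingSeparated (s : Set R) : Prop :=
  ∀ x ∈ s, ∀ y ∈ s, ∀ i j : ℕ, 2 ^ i * x = 2 ^ j * y → x = y ∨ x = -y

theorem IsDoublingSeparated.mono {s t : Set R} (ht : IsDoublingSeparated t) (hst : s ⊆ t) :
    IsDoublingSeparated s :=
  fun x hx y hy ↦ ht x (hst hx) y (hst hy)

theorem iterate_sym2Map_two_mul (i : ℕ) (x y : R) :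
    (Sym2.map (2 * ·))^[i] s(x, y) = s(2 ^ i * x, 2 ^ i * y) := by
  induction i with
  | zero => simp
  | succ i ih => rw [Function.iterate_succ_apply', ih, Sym2.map_mk, pow_succ', mul_assoc, mul_assoc]

theorem sym2Mk_neg_eq_iff {x y : R} : s(x, -x) = s(y, -y) ↔ x = y ∨ x = -y := by
  simp [neg_eq_iff_eq_neg]

theorem two_pow_signedPeriod_mul (x : R) :
    2 ^ signedPeriod x * x = x ∨ 2 ^ signedPeriod x * x = -x := by
  have h := Function.iterate_minimalPeriod (f := Sym2.map (2 * ·)) (x := s(x, -x))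
  rwa [iterate_sym2Map_two_mul, mul_neg, sym2Mk_neg_eq_iff] at h

theorem sym2Map_two_mul_ne [Invertible (3 : R)] {x : R} (hx : x ≠ 0) :
    Sym2.map (2 * ·) s(x, -x) ≠ s(x, -x) := by
  rw [Sym2.map_mk, mul_neg, Ne, sym2Mk_neg_eq_iff]
  rintro (h | h)
  · exact hx (by linear_combination h)
  · exact mul_ne_zero_of_invertible 3 hx (by linear_combination h)

theorem signedPeriod_ne_one [Invertible (3 : R)] {x : R} (hx : x ≠ 0) : signedPeriod x ≠ 1 :=
  mt Function.minimalPeriod_eq_one_iff_isFixedPt.1 (sym2Map_two_mul_ne hx)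

variable [Invertible (2 : R)]

theorem two_mul_left_injective : Function.Injective fun x : R ↦ 2 * x :=
  (isUnit_of_invertible 2).mul_right_injective

theorem exists_doublingColoring (R : Type*) [CommRing R] [Finite R] [Invertible (2 : R)]
    [Invertible (3 : R)] :
    ∃ C : DoublingColoring R, (∀ x ≠ 0, C.color x = 0 → C.color (2 * x) = 1) ∧
      (∀ x, C.color x = 0 → Odd (signedPeriod x)) ∧
      IsDoublingSeparated {x | C.color x = 0} := by
  have hf := (Sym2.map.injective (two_mul_left_injective (R := R))).mem_periodicPts
  obtain ⟨c, hne, hone, hodd, hinj⟩ := exists_orbitColoring hf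
  have hdouble (x : R) : s(2 * x, -(2 * x)) = Sym2.map (2 * ·) s(x, -x) := by simp
  refine ⟨⟨fun x ↦ c s(x, -x), fun x ↦ by rw [neg_neg, Sym2.eq_swap], fun x hx ↦ ?_⟩,
    fun x hx h ↦ ?_, fun x hx ↦ hodd _ hx, fun x hx y hy i j h ↦ ?_⟩
  · rw [hdouble]
    exact hne _ (sym2Map_two_mul_ne hx)
  · simp only [hdouble]
    exact hone _ (sym2Map_two_mul_ne hx) h
  · refine sym2Mk_neg_eq_iff.1 (hinj _ _ ?_ hx hy)
    rw [← Function.periodicOrbit_apply_iterate_eq (hf s(x, -x)) i,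
      ← Function.periodicOrbit_apply_iterate_eq (hf s(y, -y)) j, iterate_sym2Map_two_mul,
      iterate_sym2Map_two_mul, mul_neg, mul_neg, h]

theorem sum_signedPeriod_le {B A : Finset R} (hB : IsDoublingSeparated (B : Set R))
    (hA : ∀ x ∈ B, ∀ i : ℕ, 2 ^ i * x ∈ A) : ∑ x ∈ B, signedPeriod x ≤ A.card := by
  calc ∑ x ∈ B, signedPeriod x
      = (B.sigma fun x ↦ Finset.range (signedPeriod x)).card := by simp
    _ ≤ A.card := by
        refine Finset.card_le_card_of_injOn (fun p ↦ 2 ^ p.2 * p.1)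
          (fun p hp ↦ hA _ (Finset.mem_sigma.1 hp).1 _) ?_
        rintro ⟨x, i⟩ hx ⟨y, j⟩ hy (h : 2 ^ i * x = 2 ^ j * y)
        obtain ⟨hxB, hi⟩ := Finset.mem_sigma.1 hx
        obtain ⟨hyB, hj⟩ := Finset.mem_sigma.1 hy
        have hxy := sym2Mk_neg_eq_iff.2 (hB x hxB y hyB i j h)
        have hij : i = j := by
          refine Function.iterate_injOn_Iio_minimalPeriod (Finset.mem_range.1 hi)
            (by simpa [signedPeriod, hxy] using hj) ?_
          simp only [iterate_sym2Map_two_mul, mul_neg]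
          rw [h, ← mul_neg, ← mul_neg, ← iterate_sym2Map_two_mul, ← iterate_sym2Map_two_mul, hxy]
        subst hij
        obtain rfl := ((isUnit_of_invertible (2 : R)).pow i).mul_right_injective h
        rfl

end Doubling

section Counting

open scoped Finset

theorem card_natCast_mul_eq_zero_le (n m : ℕ) [NeZero n] :
    #{x : ZMod n | (m : ZMod n) * x = 0} ≤ n.gcd m := by
  refine le_trans (Finset.card_le_card fun x hx ↦ ?_)
    (IsAddCyclic.card_nsmul_eq_zero_le (α := ZMod n) (Nat.gcd_pos_of_pos_left m (NeZero.pos n)))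
  simp only [Finset.mem_filter_univ, ← nsmul_eq_mul, ← addOrderOf_dvd_iff_nsmul_eq_zero] at hx ⊢
  refine Nat.dvd_gcd ?_ hx
  simpa using addOrderOf_dvd_card (x := x)

theorem mul_card_signedPeriod_eq_le {n : ℕ} [NeZero n] [Invertible (2 : ZMod n)]
    {B : Finset (ZMod n)} (hB : IsDoublingSeparated (B : Set (ZMod n))) (hB₀ : 0 ∉ B) (l : ℕ) :
    l * #{x ∈ B | signedPeriod x = l} ≤
      (n.gcd (2 ^ l - 1) - 1) + (n.gcd (2 ^ l + 1) - 1) := by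
  let K (m : ℕ) : Finset (ZMod n) := Finset.erase {x | (m : ZMod n) * x = 0} 0
  have hK (m : ℕ) : #(K m) ≤ n.gcd m - 1 := by
    rw [Finset.card_erase_of_mem (by simp)]
    exact Nat.sub_le_sub_right (card_natCast_mul_eq_zero_le n m) 1
  have hmem {x : ZMod n} (hxB : x ∈ B) (hx : signedPeriod x = l) (i : ℕ) :
      2 ^ i * x ∈ K (2 ^ l - 1) ∪ K (2 ^ l + 1) := by
    have hne : 2 ^ i * x ≠ 0 := mul_ne_zero_of_invertible (2 ^ i) (ne_of_mem_of_not_mem hxB hB₀)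
    simp only [K, Finset.mem_union, Finset.mem_erase, Finset.mem_filter_univ]
    refine (hx ▸ two_pow_signedPeriod_mul x).imp (fun h ↦ ⟨hne, ?_⟩) fun h ↦ ⟨hne, ?_⟩
    · rw [Nat.cast_sub Nat.one_le_two_pow]
      push_cast
      linear_combination 2 ^ i * h
    · push_cast
      linear_combination 2 ^ i * h
  calc l * #{x ∈ B | signedPeriod x = l}
      = ∑ x ∈ B with signedPeriod x = l, signedPeriod x := by
        rw [Finset.sum_congr rfl fun x hx ↦ (Finset.mem_filter.1 hx).2, Finset.sum_const,
          smul_eq_mul, mul_comm]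
    _ ≤ #(K (2 ^ l - 1) ∪ K (2 ^ l + 1)) :=
        sum_signedPeriod_le (hB.mono (Finset.coe_subset.2 (Finset.filter_subset _ _)))
          fun x hx ↦ hmem (Finset.mem_filter.1 hx).1 (Finset.mem_filter.1 hx).2
    _ ≤ (n.gcd (2 ^ l - 1) - 1) + (n.gcd (2 ^ l + 1) - 1) :=
        (Finset.card_union_le _ _).trans (add_le_add (hK _) (hK _))

/-- An upper bound for the number of elements `x` of `ZMod n` of signed period `l` that are first
in their doubling orbit. -/
def periodBound (n l : ℕ) : ℕ := ((n.gcd (2 ^ l - 1) - 1) + (n.gcd (2 ^ l + 1) - 1)) / l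

theorem mul_card_le_sum_add_sum {ι : Type*} (B : Finset ι) (p : ι → ℕ)
    (hp : ∀ x ∈ B, Odd (p x) ∧ p x ≠ 1) :
    13 * #B ≤ ∑ x ∈ B, p x + ∑ l ∈ {3, 5, 7, 9, 11}, (13 - l) * #{x ∈ B | p x = l} := by
  simp only [Finset.card_filter, Finset.mul_sum]
  rw [Finset.sum_comm, ← Finset.sum_add_distrib, mul_comm, ← smul_eq_mul, ← Finset.sum_const]
  refine Finset.sum_le_sum fun x hx ↦ ?_
  obtain ⟨⟨k, hk⟩, hone⟩ := hp x hx
  simp only [hk] at hone ⊢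
  simp only [mul_ite, mul_one, mul_zero, Finset.sum_ite_eq, Finset.mem_insert, Nat.reduceEqDiff,
    ne_eq, OfNat.ofNat_ne_zero, not_false_eq_true, mul_eq_left₀, Finset.mem_singleton,
    Nat.reduceSubDiff]
  split_ifs <;> omega

theorem thirteen_mul_card_le {n : ℕ} [NeZero n] [Invertible (2 : ZMod n)]
    [Invertible (3 : ZMod n)] {B : Finset (ZMod n)}
    (hB : IsDoublingSeparated (B : Set (ZMod n))) (hB₀ : 0 ∉ B)
    (hodd : ∀ x ∈ B, Odd (signedPeriod x)) :
    13 * #B ≤ n - 1 + ∑ l ∈ {3, 5, 7, 9, 11}, (13 - l) * periodBound n l := by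
  refine (mul_card_le_sum_add_sum B _ fun x hx ↦
    ⟨hodd x hx, signedPeriod_ne_one (ne_of_mem_of_not_mem hx hB₀)⟩).trans
    (add_le_add ?_ (Finset.sum_le_sum fun l hl ↦ Nat.mul_le_mul_left _ ?_))
  · have h := sum_signedPeriod_le (A := Finset.univ.erase 0) hB fun x hx i ↦
      Finset.mem_erase.2 ⟨mul_ne_zero_of_invertible (2 ^ i) (ne_of_mem_of_not_mem hx hB₀),
        Finset.mem_univ _⟩
    simpa [Finset.card_erase_of_mem, ZMod.card] using h
  · have hpos : 0 < l := by
      simp only [Finset.mem_insert, Finset.mem_singleton] at hl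
      omega
    rw [periodBound, Nat.le_div_iff_mul_le hpos, mul_comm]
    exact mul_card_signedPeriod_eq_le hB hB₀ l

theorem periodBound_le (n : ℕ) {l : ℕ} (hl : l ≠ 0) : periodBound n l ≤ (2 ^ (l + 1) - 2) / l := by
  have := Nat.one_lt_two_pow hl
  have := Nat.gcd_le_right n (show 0 < 2 ^ l - 1 by omega)
  have := Nat.gcd_le_right n (show 0 < 2 ^ l + 1 by omega)
  exact Nat.div_le_div_right (by omega)

theorem nine_mul_sum_periodBound_lt_of_large {n : ℕ} (hn : 3600 ≤ n) :
    9 * ∑ l ∈ {3, 5, 7, 9, 11}, (13 - l) * periodBound n l < 4 * (n - 1) := by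
  have h3 := periodBound_le n (l := 3) (by decide)
  have h5 := periodBound_le n (l := 5) (by decide)
  have h7 := periodBound_le n (l := 7) (by decide)
  have h9 := periodBound_le n (l := 9) (by decide)
  have h11 := periodBound_le n (l := 11) (by decide)
  simp only [Finset.mem_insert, Nat.reduceEqDiff, Finset.mem_singleton, or_self,
    not_false_eq_true, Finset.sum_insert, Nat.reduceSub, Finset.sum_singleton, gt_iff_lt]
  omega

theorem nine_mul_sum_periodBound_lt_of_small : ∀ a < 200,
    (a ∉ ({0, 1, 4, 7} : Finset ℕ) → 9 * ∑ l ∈ {3, 5, 7, 9, 11},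
      (13 - l) * periodBound (18 * a + 1) l < 4 * (18 * a)) ∧
    (a ∉ ({0, 2, 28} : Finset ℕ) → 9 * ∑ l ∈ {3, 5, 7, 9, 11},
      (13 - l) * periodBound (18 * a + 7) l < 4 * (18 * a + 6)) := by
  decide +kernel

theorem nine_mul_sum_periodBound_lt {n : ℕ} (hn : n % 18 = 1 ∨ n % 18 = 7)
    (hne : n ∉ ({1, 7, 19, 43, 73, 127, 511} : Finset ℕ)) :
    9 * ∑ l ∈ {3, 5, 7, 9, 11}, (13 - l) * periodBound n l < 4 * (n - 1) := by
  rcases le_or_gt 3600 n with h | h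
  · exact nine_mul_sum_periodBound_lt_of_large h
  obtain ⟨h1, h7⟩ := nine_mul_sum_periodBound_lt_of_small (n / 18) (by omega)
  simp only [Finset.mem_insert, Finset.mem_singleton] at hne h1 h7
  rcases hn with hn | hn
  · rw [show 18 * (n / 18) + 1 = n by omega] at h1
    have := h1 (by omega)
    omega
  · rw [show 18 * (n / 18) + 7 = n by omega] at h7
    have := h7 (by omega)
    omega

end Counting

namespace SteinerTripleSystem

theorem exists_le_two_mul_chromaticIndex_of_mod_eq_three_or_nine {v : ℕ}
    (hv : v % 18 = 3 ∨ v % 18 = 9)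
    (hne : v ∉ ({3, 9, 21, 45, 75, 129, 513} : Finset ℕ)) :
    ∃ S : SteinerTripleSystem (Fin v), v + 3 ≤ 2 * S.chromaticIndex := by
  classical
  obtain ⟨k, rfl⟩ : ∃ k, v = 6 * k + 3 := ⟨v / 6, by omega⟩
  have : Invertible (2 : ZMod (6 * k + 1)) := ((ZMod.isUnit_iff_coprime 2 _).2 <|
    Nat.prime_two.coprime_iff_not_dvd.2 (by omega)).invertible
  have : Invertible (3 : ZMod (6 * k + 1)) := ((ZMod.isUnit_iff_coprime 3 _).2 <|
    Nat.prime_three.coprime_iff_not_dvd.2 (by omega)).invertible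
  obtain ⟨C, hC, hodd, hsep⟩ := exists_doublingColoring (ZMod (6 * k + 1))
  have hzero {x} (hx : x ∈ C.zeros.map (.subtype _)) : C.color x = 0 := by
    obtain ⟨y, hy, rfl⟩ := Finset.mem_map.1 hx
    exact (Finset.mem_filter_univ y).1 hy
  have hcard := thirteen_mul_card_le (B := C.zeros.map (.subtype _))
    (hsep.mono fun x ↦ hzero) (by simp) fun x hx ↦ hodd x (hzero hx)
  rw [Finset.card_map] at hcard
  have hbound := nine_mul_sum_periodBound_lt (n := 6 * k + 1) (by omega) (by
    simp only [Finset.mem_insert, Finset.mem_singleton] at hne ⊢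
    omega)
  obtain ⟨S, hS⟩ := C.schreiberWilson.toSteinerTripleSystem.exists_fin_chromaticIndex_le
    (v := 6 * k + 3) (by simp [ZMod.card]; omega)
  have := C.le_chromaticIndex_schreiberWilson hC (ZMod.card (6 * k + 1)) (by omega)
  exact ⟨S, by omega⟩

end SteinerTripleSystem

namespace SteinerTripleSystem

variable {V : Type*} [Fintype V] {S : SteinerTripleSystem V} {t : Finset V} {x : V}

section SmallOrders

theorem chromaticIndex_le_one (hV : Fintype.card V = 3) : S.chromaticIndex ≤ 1 := by
  have htriple : ∀ t : S.triples, (t : Finset V) = Finset.univ := fun t ↦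
    Finset.eq_univ_of_card _ ((S.card_eq_three t t.2).trans hV.symm)
  let C : S.intersectionGraph.Coloring (Fin 1) := SimpleGraph.Coloring.mk (fun _ ↦ 0)
    fun {s t} hst ↦ absurd (Subtype.ext ((htriple s).trans (htriple t).symm)) hst.1
  exact chromaticIndex_le_of_colorable C.colorable

theorem card_triples_mem_not_disjoint [DecidableEq V] (ht : t ∈ S.triples) (hx : x ∉ t) :
    {s ∈ S.triples | x ∈ s ∧ ¬Disjoint s t}.card = 3 := by
  have hne : ∀ y ∈ t, x ≠ y := fun y hy h ↦ hx (h ▸ hy)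
  choose! f hfS hxf hf using fun y (hy : y ∈ t) ↦ (S.existsUnique_triple x y (hne y hy)).exists
  have himage : {s ∈ S.triples | x ∈ s ∧ ¬Disjoint s t} = t.image f := by
    ext s
    simp only [Finset.mem_filter, Finset.mem_image, Finset.not_disjoint_iff]
    constructor
    · rintro ⟨hs, hxs, y, hys, hyt⟩
      exact ⟨y, hyt, eq_of_mem_of_mem (hfS y hyt) hs (hne y hyt) (hxf y hyt) (hf y hyt) hxs hys⟩
    · rintro ⟨y, hyt, rfl⟩
      exact ⟨hfS y hyt, hxf y hyt, y, hf y hyt, hyt⟩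
  have hinj : Set.InjOn f t := by
    intro y hy z hz hyz
    by_contra hne
    have hft : f y = t := eq_of_mem_of_mem (hfS y hy) ht hne (hf y hy) (hyz ▸ hf z hz) hy hz
    exact hx (hft ▸ hxf y hy)
  rw [himage, Finset.card_image_of_injOn hinj, S.card_eq_three t ht]

theorem card_triples_mem_of_card_eq_nine [DecidableEq V] (S : SteinerTripleSystem V)
    (hV : Fintype.card V = 9) (x : V) : {s ∈ S.triples | x ∈ s}.card = 4 := by
  have := S.two_mul_card_triples_mem x
  omega

/-- Playfair's parallel postulate: a Steiner triple system of order nine is an affine plane. -/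
theorem existsUnique_parallel (hV : Fintype.card V = 9) (ht : t ∈ S.triples) (x : V) :
    ∃! s, s ∈ S.triples ∧ x ∈ s ∧ (s = t ∨ Disjoint s t) := by
  classical
  by_cases hx : x ∈ t
  · refine ⟨t, ⟨ht, hx, .inl rfl⟩, ?_⟩
    rintro s ⟨-, hxs, rfl | hst⟩
    · rfl
    · exact absurd hx (Finset.disjoint_left.1 hst hxs)
  · have hmeet := card_triples_mem_not_disjoint ht hx
    have hsplit := Finset.card_filter_add_card_filter_not (s := {s ∈ S.triples | x ∈ s})
      (fun s ↦ Disjoint s t)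
    rw [Finset.filter_filter, Finset.filter_filter, hmeet,
      S.card_triples_mem_of_card_eq_nine hV x] at hsplit
    obtain ⟨s, hs⟩ := Finset.card_eq_one.1 (Nat.add_right_cancel hsplit)
    have hmem : ∀ u, u ∈ S.triples ∧ x ∈ u ∧ Disjoint u t ↔ u = s := fun u ↦ by
      rw [← Finset.mem_singleton, ← hs, Finset.mem_filter]
    have hor : ∀ u, x ∈ u → (u = t ∨ Disjoint u t ↔ Disjoint u t) := fun u hxu ↦
      or_iff_right fun h ↦ hx (h ▸ hxu)
    refine ⟨s, ?_, fun u ⟨hu, hxu, hut⟩ ↦ (hmem u).1 ⟨hu, hxu, (hor u hxu).1 hut⟩⟩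
    obtain ⟨hsS, hxs, hst⟩ := (hmem s).2 rfl
    exact ⟨hsS, hxs, .inr hst⟩

theorem chromaticIndex_le_four (hV : Fintype.card V = 9) : S.chromaticIndex ≤ 4 := by
  classical
  obtain ⟨p⟩ : Nonempty V := Fintype.card_pos_iff.1 (by omega)
  choose f hfS hpf hf using fun t : S.triples ↦ (existsUnique_parallel hV t.2 p).exists
  have hparallel : ∀ t : S.triples, (t : Finset V) = f t ∨ Disjoint (t : Finset V) (f t) :=
    fun t ↦ (hf t).imp Eq.symm (Disjoint.symm ·)
  let C : S.intersectionGraph.Coloring {s ∈ S.triples | p ∈ s} :=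
    SimpleGraph.Coloring.mk (fun t ↦ ⟨f t, Finset.mem_filter.2 ⟨hfS t, hpf t⟩⟩) <| by
      intro s t hst heq
      have hft : f t = f s := (congrArg Subtype.val heq).symm
      obtain ⟨y, hys, hyt⟩ := Finset.not_disjoint_iff.1 hst.2
      exact hst.1 (Subtype.ext ((existsUnique_parallel hV (hfS s) y).unique
        ⟨s.2, hys, hparallel s⟩ ⟨t.2, hyt, hft ▸ hparallel t⟩))
  have hC := C.colorable
  rw [Fintype.card_coe, S.card_triples_mem_of_card_eq_nine hV p] at hC
  exact chromaticIndex_le_of_colorable hC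

end SmallOrders

end SteinerTripleSystem

theorem theorem1 (v : ℕ) (hv : v ≡ 3 [MOD 6]) :
    (v ∉ ({3, 9, 45, 75, 129, 513} : Set ℕ) →
      ∃ S : SteinerTripleSystem (Fin v), ((v : ℚ) + 3) / 2 ≤ (S.chromaticIndex : ℚ)) ∧
    (v ∈ ({3, 9} : Set ℕ) →
      ∀ (V : Type*) [Fintype V], Fintype.card V = v →
        ¬ ∃ S : SteinerTripleSystem V, ((v : ℚ) + 3) / 2 ≤ (S.chromaticIndex : ℚ)) := by
  have hhalf : ∀ n : ℕ, ((v : ℚ) + 3) / 2 ≤ n ↔ v + 3 ≤ 2 * n := fun n ↦ by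
    rw [div_le_iff₀' two_pos]
    exact_mod_cast Iff.rfl
  simp only [hhalf]
  refine ⟨fun hne ↦ ?_, ?_⟩
  · have hmod : v % 18 = 3 ∨ v % 18 = 9 ∨ v % 18 = 15 := by
      have : v % 6 = 3 := hv
      omega
    rcases eq_or_ne v 21 with rfl | h21
    · exact SteinerTripleSystem.exists_le_two_mul_chromaticIndex_twentyOne
    rcases or_assoc.2 hmod with h | h
    · refine SteinerTripleSystem.exists_le_two_mul_chromaticIndex_of_mod_eq_three_or_nine h ?_
      simp_all
    · exact SteinerTripleSystem.exists_le_two_mul_chromaticIndex_of_mod_eq_fifteen h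
  · rintro (rfl | rfl) V _ hV ⟨S, hS⟩
    · have := S.chromaticIndex_le_one hV
      omega
    · have := S.chromaticIndex_le_four hV
      omega
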